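/- Let $\mathcal{L}$ be a complex Hilbert space (for instance the Hilbert--Schmidt operators $\mathcal{B}_{\mathrm{HS}}(\mathcal{H}_s)$ on a Hilbert space $\mathcal{H}_s$) and let $\mathcal{B}=\mathcal{B}(\mathcal{L})$ be the space of bounded operators on $\mathcal{L}$ with the operator norm. For $A\in\mathcal{B}$ write $A'=\tfrac12(A+A^\dagger)$ and $A''=\tfrac1{2i}(A-A^\dagger)$. Let $\mathcal{K}:\mathbb{R}\to\mathcal{B}$ be causal, that is, $\mathcal{K}(t)=0$ for $t<0$, and absolutely (Bochner) integrable, and suppose that its transform $\tilde{\mathcal{K}}(z)=\int_0^\infty e^{izt}\mathcal{K}(t)\,dt$, $\operatorname{Im}z>0$, lies in the Hardy space $H^1(\mathcal{B})$ of the upper half-plane: $\tilde{\mathcal{K}}$ is analytic there and $\sup_{y>0}\int_{\mathbb{R}}\|\tilde{\mathcal{K}}(x+iy)\|\,dx<\infty$. Then $\tilde{\mathcal{K}}$ has non-tangential boundary values $\tilde{\mathcal{K}}(\omega)$ in operator norm at almost every $\omega\in\mathbb{R}$, and for almost every $\omega\in\mathbb{R}$ $$\tilde{\mathcal{K}}'(\omega)=\frac1\pi\,\mathcal{P}\!\!\int_{-\infty}^{\infty}\frac{\tilde{\mathcal{K}}''(\omega')}{\omega'-\omega}\,d\omega',$$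 where the principal value exists as the operator-norm limit, as $\varepsilon\downarrow0$, of the Bochner integrals over $|\omega'-\omega|>\varepsilon$. Moreover, for almost every $\omega\in\mathbb{R}$ and all $\xi,\eta\in\mathcal{L}$, the same relation holds for matrix elements: the following principal value exists and $$\operatorname{Re}\langle\xi,\tilde{\mathcal{K}}(\omega)\eta\rangle=\frac1\pi\,\mathcal{P}\!\!\int_{-\infty}^{\infty}\frac{\operatorname{Im}\langle\xi,\tilde{\mathcal{K}}(\omega')\eta\rangle}{\omega'-\omega}\,d\omega'.$$ -/

import Mathlib

open MeasureTheory Filter Topology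

namespace KramersKronig

/-- The open upper half-plane `{z : Im z > 0}`. -/
def upperHalf : Set ℂ := {z : ℂ | 0 < z.im}

section BanachValued

variable {B : Type*} [NormedAddCommGroup B] [NormedSpace ℂ B]

/-- A function of time is causal if its support lies in `[0, ∞)`. -/
def IsCausal (K : ℝ → B) : Prop := Function.support K ⊆ Set.Ici 0

/-- The Laplace transform `K̃(z) = ∫₀^∞ e^{izt} K(t) dt` (Bochner integral). -/
noncomputable def laplace (K : ℝ → B) (z : ℂ) : B :=
  ∫ t in Set.Ioi (0 : ℝ), Complex.exp (Complex.I * z * (t : ℂ)) • K t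

/-- The Hardy norm `sup_{y > 0} (∫ ‖F(x + iy)‖^p dx)^{1/p}`, with values in `[0, ∞]`. -/
noncomputable def hardyNorm (p : ENNReal) (F : ℂ → B) : ENNReal :=
  ⨆ (y : ℝ) (_ : 0 < y), eLpNorm (fun x : ℝ => F ((x : ℂ) + (y : ℂ) * Complex.I)) p volume

/-- Membership in the vector-valued Hardy space `H^p` of the upper half-plane. -/
def MemHardy (p : ENNReal) (F : ℂ → B) : Prop :=
  DifferentiableOn ℂ F upperHalf ∧ hardyNorm p F < ⊤

/-- The cone of aperture `α` in the upper half-plane with vertex at the real point `ω`. -/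
def cone (α ω : ℝ) : Set ℂ := {z : ℂ | 0 < z.im ∧ |z.re - ω| < α * z.im}

/-- `b` is the non-tangential boundary value of `F` at the real point `ω`, in norm. -/
def HasBoundaryValue (F : ℂ → B) (ω : ℝ) (b : B) : Prop :=
  ∀ α : ℝ, 0 < α → Tendsto F (𝓝[cone α ω] (ω : ℂ)) (𝓝 b)

end BanachValued

/-- `v` is the principal value `P ∫ f(s) / (s - ω) ds`, as a norm limit of (absolutely convergent)
Bochner integrals over `|s - ω| > ε`. -/
def HasPrincipalValue {V : Type*} [NormedAddCommGroup V] [NormedSpace ℝ V]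
    (f : ℝ → V) (ω : ℝ) (v : V) : Prop :=
  (∀ ε : ℝ, 0 < ε → IntegrableOn (fun s : ℝ => (s - ω)⁻¹ • f s) {s : ℝ | ε < |s - ω|} volume) ∧
    Tendsto (fun ε : ℝ => ∫ s in {s : ℝ | ε < |s - ω|}, (s - ω)⁻¹ • f s) (𝓝[>] 0) (𝓝 v)

section Operators

variable {L : Type*} [NormedAddCommGroup L] [InnerProductSpace ℂ L] [CompleteSpace L]

/-- The real part `(A + A†) / 2` of a bounded operator. -/
noncomputable def opRe (A : L →L[ℂ] L) : L →L[ℂ] L := (realPart A : L →L[ℂ] L)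

/-- The imaginary part `(A - A†) / (2i)` of a bounded operator. -/
noncomputable def opIm (A : L →L[ℂ] L) : L →L[ℂ] L := (imaginaryPart A : L →L[ℂ] L)

end Operators

end KramersKronig

/-!
As `K` is integrable and `laplace` integrates over `t > 0` only, `F = laplace K` is bounded and, by dominated
convergence, continuous on the *closed* upper half-plane; so the boundary value exists at every real
point and is just `F ω`. The same theorem gives `F z → 0` as `Im z → ∞`. The Hardy norm enters
through Fatou's lemma: it makes the boundary function integrable, so that the truncated
principal-value integrals converge absolutely.

For a function with these properties, Cauchy's theorem on the half annulus
`{z : ε ≤ |z - ω| ≤ R, Im z ≥ 0}`, which is the image of a rectangle under `w ↦ ω + exp w`, reads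
`∫_ε^R (F (ω + u) - F (ω - u)) / u du = i ∫_0^π F (ω + ε e^{iy}) dy - i ∫_0^π F (ω + R e^{iy}) dy`.
Letting `R → ∞` and then `ε → 0` gives `P ∫ F(s) / (s - ω) ds = i π F ω` for every `ω`, in norm
(`hasPrincipalValue_of_upperHalf`). No geometric property of the Banach space is needed.

The Kramers–Kronig relations are the images of this identity under the continuous real-linear maps
`A ↦ opIm A` and `A ↦ Im ⟪ξ, A η⟫`, as `Im (i π A) = π Re A`.
-/

namespace KramersKronig

open Complex Set

/-- The closed upper half-plane `{z : 0 ≤ Im z}`. -/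
def closedUpperHalf : Set ℂ := {z : ℂ | 0 ≤ z.im}

/-! ### Principal values and real-linear maps -/

/-- The truncated domain of a principal value is a pair of half-lines. -/
lemma setOf_lt_abs_sub (ε ω : ℝ) :
    {s : ℝ | ε < |s - ω|} = Iio (ω - ε) ∪ Ioi (ω + ε) := by
  ext s
  simp only [mem_ofPred_eq, lt_abs, mem_union, mem_Iio, mem_Ioi]
  constructor <;> rintro (h | h) <;> [right; left; right; left] <;> linarith

lemma HasPrincipalValue.map {V W : Type*} [NormedAddCommGroup V] [NormedSpace ℝ V]
    [CompleteSpace V] [NormedAddCommGroup W] [NormedSpace ℝ W] [CompleteSpace W]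
    {f : ℝ → V} {ω : ℝ} {v : V} (h : HasPrincipalValue f ω v) (T : V →L[ℝ] W) :
    HasPrincipalValue (fun s => T (f s)) ω (T v) := by
  refine ⟨fun ε hε => ?_, ?_⟩
  · simpa only [map_smul] using! T.integrable_comp (h.1 ε hε)
  · refine ((T.continuous.tendsto v).comp h.2).congr' ?_
    filter_upwards [self_mem_nhdsWithin] with ε hε
    simpa using (T.integral_comp_comm (h.1 ε hε)).symm

lemma integrableOn_inv_sub_smul {V : Type*} [NormedAddCommGroup V] [NormedSpace ℝ V]
    {f : ℝ → V} (hf : Integrable f) (ω : ℝ) {ε : ℝ} (hε : 0 < ε) :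
    IntegrableOn (fun s : ℝ => (s - ω)⁻¹ • f s) {s : ℝ | ε < |s - ω|} := by
  have hmeas : MeasurableSet {s : ℝ | ε < |s - ω|} := by
    rw [setOf_lt_abs_sub]; exact measurableSet_Iio.union measurableSet_Ioi
  refine Integrable.mono' (hf.norm.const_mul ε⁻¹).integrableOn
    ((by fun_prop : Measurable fun s : ℝ => (s - ω)⁻¹).aestronglyMeasurable.smul
      hf.aestronglyMeasurable).restrict ?_
  filter_upwards [ae_restrict_mem hmeas] with s hs
  rw [norm_smul, norm_inv, Real.norm_eq_abs]
  gcongr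

/-- Reflecting at `ω` turns the truncated integral into one over a half-line, the form in which
the half annulus produces it. -/
lemma setIntegral_inv_sub_smul_eq {V : Type*} [NormedAddCommGroup V] [NormedSpace ℝ V]
    {f : ℝ → V} (hf : Integrable f) (ω : ℝ) {ε : ℝ} (hε : 0 < ε) :
    IntegrableOn (fun u : ℝ => u⁻¹ • (f (ω + u) - f (ω - u))) (Ioi ε) ∧
    ∫ s in {s : ℝ | ε < |s - ω|}, (s - ω)⁻¹ • f s =
      ∫ u in Ioi ε, u⁻¹ • (f (ω + u) - f (ω - u)) := by
  have hi := integrableOn_inv_sub_smul hf ω hε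
  rw [setOf_lt_abs_sub] at hi ⊢
  have hl := hi.mono_set subset_union_left
  have hr := hi.mono_set subset_union_right
  have pr : MeasurePreserving (fun u : ℝ => ω + u) := measurePreserving_add_left volume ω
  have er : MeasurableEmbedding (fun u : ℝ => ω + u) := measurableEmbedding_addLeft ω
  have pl : MeasurePreserving (fun u : ℝ => ω - u) := Measure.measurePreserving_sub_left volume ω
  have el : MeasurableEmbedding (fun u : ℝ => ω - u) :=
    (Homeomorph.subLeft ω).measurableEmbedding
  have sr : (fun u : ℝ => ω + u) ⁻¹' Ioi (ω + ε) = Ioi ε := by ext; simp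
  have sl : (fun u : ℝ => ω - u) ⁻¹' Iio (ω - ε) = Ioi ε := by ext; simp
  have ir := (pr.integrableOn_comp_preimage er).2 hr
  have il := (pl.integrableOn_comp_preimage el).2 hl
  have vr := pr.setIntegral_preimage_emb er (fun s => (s - ω)⁻¹ • f s) (Ioi (ω + ε))
  have vl := pl.setIntegral_preimage_emb el (fun s => (s - ω)⁻¹ • f s) (Iio (ω - ε))
  rw [sr] at ir vr
  rw [sl] at il vl
  have hsum : (fun u : ℝ => u⁻¹ • (f (ω + u) - f (ω - u))) =
      fun u => ((ω - u) - ω)⁻¹ • f (ω - u) + ((ω + u) - ω)⁻¹ • f (ω + u) := by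
    funext u
    rw [sub_sub_cancel_left, add_sub_cancel_left, inv_neg, neg_smul, smul_sub]
    abel
  have hdisj : Disjoint (Iio (ω - ε)) (Ioi (ω + ε)) := by
    rw [Set.disjoint_left]
    intro s hs hs'
    simp only [mem_Iio, mem_Ioi] at hs hs'
    linarith
  rw [hsum]
  refine ⟨il.add ir, ?_⟩
  rw [setIntegral_union hdisj measurableSet_Ioi hl hr, ← vr, ← vl]
  exact (integral_add il ir).symm

/-! ### Cauchy's theorem on a half annulus -/

section Contour

variable {B : Type*} [NormedAddCommGroup B] [NormedSpace ℂ B] {F : ℂ → B}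

lemma im_ofReal_add_exp (ω : ℝ) (w : ℂ) :
    ((ω : ℂ) + exp w).im = Real.exp w.re * Real.sin w.im := by
  simp [exp_im]

/-- `π` times the mean of `F` over the upper half circle of radius `r` around `ω`, with respect to
the angle; `i` times it is the contour integral of `F z / (z - ω)`. -/
noncomputable def semicircleIntegral (F : ℂ → B) (ω r : ℝ) : B :=
  ∫ y in (0 : ℝ)..Real.pi, F ((ω : ℂ) + r * exp (y * I))

lemma mem_closedUpperHalf_semicircle (ω : ℝ) {r y : ℝ} (hr : 0 ≤ r) (hy : y ∈ Icc 0 Real.pi) :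
    (ω : ℂ) + r * exp (y * I) ∈ closedUpperHalf := by
  have : ((ω : ℂ) + r * exp (y * I)).im = r * Real.sin y := by simp [exp_ofReal_mul_I_im]
  change 0 ≤ ((ω : ℂ) + r * exp (y * I)).im
  rw [this]
  exact mul_nonneg hr (Real.sin_nonneg_of_mem_Icc hy)

lemma intervalIntegral_half_annulus [CompleteSpace B] (hc : ContinuousOn F closedUpperHalf)
    (hd : DifferentiableOn ℂ F upperHalf) (ω : ℝ) {ε R : ℝ} (hε : 0 < ε) (hR : ε ≤ R) :
    ∫ u in ε..R, u⁻¹ • (F ((ω + u : ℝ) : ℂ) - F ((ω - u : ℝ) : ℂ)) =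
      I • semicircleIntegral F ω ε - I • semicircleIntegral F ω R := by
  have hR0 : 0 < R := hε.trans_le hR
  set G : ℂ → B := fun w => F (ω + exp w) with hG
  have hmaps : MapsTo (fun w : ℂ => (ω : ℂ) + exp w)
      (uIcc (Real.log ε) (Real.log R) ×ℂ uIcc 0 Real.pi) closedUpperHalf := by
    intro w hw
    rw [uIcc_of_le Real.pi_pos.le] at hw
    change 0 ≤ ((ω : ℂ) + exp w).im
    rw [im_ofReal_add_exp]
    exact mul_nonneg (Real.exp_pos _).le (Real.sin_nonneg_of_mem_Icc hw.2)
  have key := integral_boundary_rect_eq_zero_of_continuousOn_of_differentiableOn G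
    (Real.log ε : ℂ) ((Real.log R : ℂ) + Real.pi * I)
    (by
      simp only [ofReal_re, ofReal_im, add_re, add_im, mul_re, mul_im, I_re, I_im]
      simp only [mul_zero, sub_self, add_zero, mul_one, zero_add]
      exact hc.comp (by fun_prop) hmaps)
    (by
      simp only [ofReal_re, ofReal_im, add_re, add_im, mul_re, mul_im, I_re, I_im]
      simp only [mul_zero, sub_self, add_zero, mul_one, zero_add]
      refine hd.comp (by fun_prop) ?_
      intro w hw
      rw [min_eq_left Real.pi_pos.le, max_eq_right Real.pi_pos.le] at hw
      change 0 < ((ω : ℂ) + exp w).im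
      rw [im_ofReal_add_exp]
      exact mul_pos (Real.exp_pos _) (Real.sin_pos_of_mem_Ioo hw.2))
  simp only [ofReal_re, ofReal_im, add_re, add_im, mul_re, mul_im, I_re, I_im, mul_zero,
    zero_mul, sub_self, add_zero, mul_one, zero_add, ofReal_zero] at key
  have hcirc : ∀ {r : ℝ}, 0 < r →
      (∫ y in (0 : ℝ)..Real.pi, G ((Real.log r : ℂ) + y * I)) = semicircleIntegral F ω r := by
    intro r hr
    simp only [hG, semicircleIntegral, exp_add, ← ofReal_exp, Real.exp_log hr]
  rw [hcirc hε, hcirc hR0] at key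
  have hbot : ∀ x : ℝ, G (x : ℂ) = F ((ω + Real.exp x : ℝ) : ℂ) := by
    intro x; simp [hG]
  have htop : ∀ x : ℝ, G ((x : ℂ) + Real.pi * I) = F ((ω - Real.exp x : ℝ) : ℂ) := by
    intro x; simp [hG, exp_add, exp_pi_mul_I, sub_eq_add_neg]
  simp only [hbot, htop] at key
  have hreal : Continuous fun s : ℝ => F (s : ℂ) :=
    hc.comp_continuous continuous_ofReal fun s => by simp [closedUpperHalf]
  have c1 : Continuous fun x : ℝ => F ((ω + Real.exp x : ℝ) : ℂ) := hreal.comp (by fun_prop)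
  have c2 : Continuous fun x : ℝ => F ((ω - Real.exp x : ℝ) : ℂ) := hreal.comp (by fun_prop)
  rw [← intervalIntegral.integral_sub (c1.intervalIntegrable _ _) (c2.intervalIntegrable _ _)]
    at key
  have hne : ∀ u ∈ uIcc ε R, u ≠ 0 := fun u hu => by
    rw [uIcc_of_le hR] at hu; exact (hε.trans_le hu.1).ne'
  -- substitute `x = log u`, for which `dx = du / u`
  have sub := intervalIntegral.integral_deriv_smul_comp'' (a := ε) (b := R) (f := Real.log)
    (f' := fun u => u⁻¹)
    (g := fun x => F ((ω + Real.exp x : ℝ) : ℂ) - F ((ω - Real.exp x : ℝ) : ℂ))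
    (Real.continuousOn_log.mono hne)
    (fun u hu => (Real.hasDerivAt_log (hne u (Ioo_subset_Icc_self hu))).hasDerivWithinAt)
    (continuousOn_inv₀.mono hne) (c1.sub c2).continuousOn
  rw [← sub] at key
  have hcongr : ∫ u in ε..R, u⁻¹ • (F ((ω + u : ℝ) : ℂ) - F ((ω - u : ℝ) : ℂ)) =
      ∫ u in ε..R, u⁻¹ • ((fun x => F ((ω + Real.exp x : ℝ) : ℂ) -
        F ((ω - Real.exp x : ℝ) : ℂ)) ∘ Real.log) u := by
    refine intervalIntegral.integral_congr fun u hu => ?_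
    rw [uIcc_of_le hR] at hu
    simp only [Function.comp, Real.exp_log (hε.trans_le hu.1)]
  rw [hcongr, ← sub_eq_zero, ← key]
  abel

lemma tendsto_semicircleIntegral [CompleteSpace B] {l : Filter ℝ} [l.IsCountablyGenerated] {ω C : ℝ} {b : B}
    (hc : ContinuousOn F closedUpperHalf) (hC : ∀ z ∈ closedUpperHalf, ‖F z‖ ≤ C)
    (hl : ∀ᶠ r in l, 0 < r)
    (hlim : ∀ y ∈ Ioo 0 Real.pi, Tendsto (fun r : ℝ => F ((ω : ℂ) + r * exp (y * I))) l (𝓝 b)) :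
    Tendsto (semicircleIntegral F ω) l (𝓝 (Real.pi • b)) := by
  have hb : Real.pi • b = ∫ _ in (0 : ℝ)..Real.pi, b := by simp
  rw [hb]
  refine intervalIntegral.tendsto_integral_filter_of_dominated_convergence (fun _ => C) ?_ ?_
    intervalIntegrable_const ?_
  · filter_upwards [hl] with r hr
    rw [uIoc_of_le Real.pi_pos.le]
    refine ContinuousOn.aestronglyMeasurable ?_ measurableSet_Ioc
    exact hc.comp (by fun_prop) fun y hy =>
      mem_closedUpperHalf_semicircle ω hr.le (Ioc_subset_Icc_self hy)
  · filter_upwards [hl] with r hr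
    refine Eventually.of_forall fun y hy => ?_
    rw [uIoc_of_le Real.pi_pos.le] at hy
    exact hC _ (mem_closedUpperHalf_semicircle ω hr.le (Ioc_subset_Icc_self hy))
  · have hpi : ∀ᵐ y : ℝ, y ≠ Real.pi := by simp [ae_iff]
    filter_upwards [hpi] with y hy hy'
    rw [uIoc_of_le Real.pi_pos.le] at hy'
    exact hlim y ⟨hy'.1, lt_of_le_of_ne hy'.2 hy⟩

/-- The Plemelj formula on the boundary of the upper half-plane, at every boundary point. -/
theorem hasPrincipalValue_of_upperHalf [CompleteSpace B] {C : ℝ}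
    (hc : ContinuousOn F closedUpperHalf) (hd : DifferentiableOn ℂ F upperHalf)
    (hC : ∀ z ∈ closedUpperHalf, ‖F z‖ ≤ C)
    (hdecay : Tendsto F (comap im atTop) (𝓝 0))
    (hint : Integrable fun s : ℝ => F s) (ω : ℝ) :
    HasPrincipalValue (fun s : ℝ => F s) ω (I • Real.pi • F ω) := by
  have hlarge : Tendsto (semicircleIntegral F ω) atTop (𝓝 (Real.pi • 0)) := by
    refine tendsto_semicircleIntegral hc hC (eventually_gt_atTop 0) fun y hy => ?_
    refine hdecay.comp (tendsto_comap_iff.2 ?_)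
    have : (im ∘ fun r : ℝ => (ω : ℂ) + r * exp (y * I)) = fun r => r * Real.sin y := by
      funext r; simp [exp_ofReal_mul_I_im]
    rw [this]
    exact tendsto_id.atTop_mul_const (Real.sin_pos_of_mem_Ioo hy)
  have hsmall : Tendsto (semicircleIntegral F ω) (𝓝[>] 0) (𝓝 (Real.pi • F ω)) := by
    refine tendsto_semicircleIntegral hc hC self_mem_nhdsWithin fun y hy => ?_
    refine (hc (ω : ℂ) (by simp [closedUpperHalf])).tendsto.comp
      (tendsto_nhdsWithin_iff.2 ⟨?_, ?_⟩)
    · have : Continuous fun r : ℝ => (ω : ℂ) + r * exp (y * I) := by fun_prop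
      simpa using (this.tendsto 0).mono_left nhdsWithin_le_nhds
    · filter_upwards [self_mem_nhdsWithin] with r hr
      exact mem_closedUpperHalf_semicircle ω (le_of_lt hr) (Ioo_subset_Icc_self hy)
  refine ⟨fun ε hε => integrableOn_inv_sub_smul hint ω hε, ?_⟩
  refine (hsmall.const_smul I).congr' ?_
  filter_upwards [self_mem_nhdsWithin] with ε hε
  obtain ⟨hi, he⟩ := setIntegral_inv_sub_smul_eq hint ω hε
  rw [he]
  refine tendsto_nhds_unique ?_ (intervalIntegral_tendsto_integral_Ioi ε hi tendsto_id)
  have := (hlarge.const_smul I).const_sub (I • semicircleIntegral F ω ε)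
  simp only [smul_zero, sub_zero] at this
  refine this.congr' ?_
  filter_upwards [eventually_ge_atTop ε] with R hR
  exact (intervalIntegral_half_annulus hc hd ω hε hR).symm

end Contour

/-! ### The Laplace transform on the closed half-plane -/

section Laplace

variable {B : Type*} [NormedAddCommGroup B] [NormedSpace ℂ B] {K : ℝ → B}

lemma norm_laplace_kernel_le {z : ℂ} (hz : z ∈ closedUpperHalf) {t : ℝ} (ht : 0 < t) (b : B) :
    ‖exp (I * z * t) • b‖ ≤ ‖b‖ := by
  rw [norm_smul, norm_exp]
  have hre : (I * z * t).re = -(z.im * t) := by simp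
  refine mul_le_of_le_one_left (norm_nonneg _) (Real.exp_le_one_iff.2 ?_)
  rw [hre]
  exact neg_nonpos.2 (mul_nonneg hz ht.le)

lemma aestronglyMeasurable_laplace_kernel (hK : Integrable K) (z : ℂ) :
    AEStronglyMeasurable (fun t : ℝ => exp (I * z * t) • K t) (volume.restrict (Ioi 0)) :=
  ((by fun_prop : Continuous fun t : ℝ => exp (I * z * t)).aestronglyMeasurable.smul
    hK.aestronglyMeasurable).restrict

lemma continuousOn_laplace (hK : Integrable K) : ContinuousOn (laplace K) closedUpperHalf := by
  refine continuousOn_of_dominated (bound := fun t => ‖K t‖)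
    (fun z _ => aestronglyMeasurable_laplace_kernel hK z) (fun z hz => ?_) hK.norm.restrict ?_
  · filter_upwards [ae_restrict_mem measurableSet_Ioi] with t ht
    exact norm_laplace_kernel_le hz ht _
  · exact Eventually.of_forall fun t => by fun_prop

lemma norm_laplace_le (hK : Integrable K) {z : ℂ} (hz : z ∈ closedUpperHalf) :
    ‖laplace K z‖ ≤ ∫ t in Ioi (0 : ℝ), ‖K t‖ := by
  refine norm_integral_le_of_norm_le hK.norm.restrict ?_
  filter_upwards [ae_restrict_mem measurableSet_Ioi] with t ht
  exact norm_laplace_kernel_le hz ht _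

lemma tendsto_laplace_comap_im_atTop (hK : Integrable K) :
    Tendsto (laplace K) (comap im atTop) (𝓝 0) := by
  have him : Tendsto im (comap im atTop) atTop := tendsto_comap
  have h0 : (0 : B) = ∫ _ in Ioi (0 : ℝ), (0 : B) := by simp
  rw [h0]
  refine tendsto_integral_filter_of_dominated_convergence (fun t => ‖K t‖)
    (Eventually.of_forall fun z => aestronglyMeasurable_laplace_kernel hK z) ?_
    hK.norm.restrict ?_
  · filter_upwards [him.eventually (eventually_ge_atTop 0)] with z hz
    filter_upwards [ae_restrict_mem measurableSet_Ioi] with t ht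
    exact norm_laplace_kernel_le hz ht _
  · filter_upwards [ae_restrict_mem measurableSet_Ioi] with t ht
    rw [tendsto_zero_iff_norm_tendsto_zero]
    have he : ∀ z : ℂ, ‖exp (I * z * t) • K t‖ = Real.exp (-(z.im * t)) * ‖K t‖ := by
      intro z
      rw [norm_smul, norm_exp]
      simp
    simp only [he]
    have := (Real.tendsto_exp_neg_atTop_nhds_zero.comp
      (him.atTop_mul_const (show (0 : ℝ) < t from ht))).mul_const ‖K t‖
    simpa [Function.comp_def] using this

lemma hasBoundaryValue_laplace (hK : Integrable K) (ω : ℝ) :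
    HasBoundaryValue (laplace K) ω (laplace K ω) := fun _ _ =>
  (continuousOn_laplace hK (ω : ℂ) (by simp [closedUpperHalf])).mono_left
    (nhdsWithin_mono _ fun _ hz => hz.1.le)

/-- The boundary function is integrable, by Fatou's lemma along the lines `Im z = 1 / (n + 1)`. -/
lemma integrable_laplace_ofReal (hK : Integrable K) (hH : MemHardy 1 (laplace K)) :
    Integrable fun s : ℝ => laplace K s := by
  have hcont := continuousOn_laplace hK
  have hreal : Continuous fun s : ℝ => laplace K (s : ℂ) :=
    hcont.comp_continuous continuous_ofReal fun s => by simp [closedUpperHalf]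
  refine ⟨hreal.aestronglyMeasurable, ?_⟩
  set y : ℕ → ℝ := fun n => 1 / ((n : ℝ) + 1) with hy
  have hypos : ∀ n, 0 < y n := fun n => Nat.one_div_pos_of_nat
  have hline : ∀ n, Continuous fun x : ℝ => laplace K ((x : ℂ) + (y n : ℂ) * I) := fun n =>
    hcont.comp_continuous (by fun_prop) fun x => by simp [closedUpperHalf, (hypos n).le]
  have hlim : ∀ x : ℝ, Tendsto (fun n => ‖laplace K ((x : ℂ) + (y n : ℂ) * I)‖ₑ) atTop
      (𝓝 ‖laplace K x‖ₑ) := by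
    intro x
    refine ((hcont (x : ℂ) (by simp [closedUpperHalf])).tendsto.comp
      (tendsto_nhdsWithin_iff.2 ⟨?_, ?_⟩)).enorm
    · have h1 : Tendsto y atTop (𝓝 0) := tendsto_one_div_add_atTop_nhds_zero_nat
      have h2 : Continuous fun r : ℝ => (x : ℂ) + (r : ℂ) * I := by fun_prop
      simpa [Function.comp_def] using (h2.tendsto 0).comp h1
    · exact Eventually.of_forall fun n => by simp [closedUpperHalf, (hypos n).le]
  have hle : ∀ n, ∫⁻ x : ℝ, ‖laplace K ((x : ℂ) + (y n : ℂ) * I)‖ₑ ≤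
      hardyNorm 1 (laplace K) := by
    intro n
    rw [← eLpNorm_one_eq_lintegral_enorm]
    exact le_iSup₂ (f := fun (y : ℝ) (_ : 0 < y) =>
      eLpNorm (fun x : ℝ => laplace K ((x : ℂ) + (y : ℂ) * I)) 1 volume) (y n) (hypos n)
  refine lt_of_le_of_lt ?_ hH.2
  calc ∫⁻ x : ℝ, ‖laplace K x‖ₑ
      = ∫⁻ x : ℝ, liminf (fun n => ‖laplace K ((x : ℂ) + (y n : ℂ) * I)‖ₑ) atTop :=
        lintegral_congr fun x => (hlim x).liminf_eq.symm
    _ ≤ liminf (fun n => ∫⁻ x : ℝ, ‖laplace K ((x : ℂ) + (y n : ℂ) * I)‖ₑ) atTop :=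
        lintegral_liminf_le fun n => (hline n).enorm.measurable
    _ ≤ hardyNorm 1 (laplace K) :=
        liminf_le_of_le (by isBoundedDefault) fun b hb => by
          obtain ⟨n, hn⟩ := hb.exists
          exact hn.trans (hle n)

theorem hasPrincipalValue_laplace [CompleteSpace B] (hK : Integrable K)
    (hH : MemHardy 1 (laplace K)) (ω : ℝ) :
    HasPrincipalValue (fun s : ℝ => laplace K s) ω (I • Real.pi • laplace K ω) :=
  hasPrincipalValue_of_upperHalf (continuousOn_laplace hK) hH.1 (fun _ hz => norm_laplace_le hK hz)
    (tendsto_laplace_comap_im_atTop hK) (integrable_laplace_ofReal hK hH) ω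

end Laplace

/-! ### Real and imaginary parts of operators and matrix elements -/

section Operators

variable {L : Type*} [NormedAddCommGroup L] [InnerProductSpace ℂ L]

/-- `A ↦ Im ⟪ξ, A η⟫` as a continuous real-linear map. -/
noncomputable def imMatrixElementCLM (ξ η : L) : (L →L[ℂ] L) →L[ℝ] ℝ :=
  imCLM.comp (((innerSL ℂ ξ).comp (ContinuousLinearMap.apply ℂ L η)).restrictScalars ℝ)

lemma imMatrixElementCLM_apply (ξ η : L) (A : L →L[ℂ] L) :
    imMatrixElementCLM ξ η A = (inner ℂ ξ (A η)).im := rfl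

lemma imMatrixElementCLM_I_smul (ξ η : L) (A : L →L[ℂ] L) :
    imMatrixElementCLM ξ η (I • Real.pi • A) = Real.pi * (inner ℂ ξ (A η)).re := by
  rw [smul_comm, map_smul, imMatrixElementCLM_apply]
  simp

variable [CompleteSpace L]

/-- `A ↦ opIm A` as a continuous real-linear map. -/
noncomputable def opImCLM : (L →L[ℂ] L) →L[ℝ] (L →L[ℂ] L) where
  toFun := opIm
  map_add' A A' := by simp [opIm]
  map_smul' c A := by simp [opIm]
  cont := by
    have : (opIm : (L →L[ℂ] L) → _) = fun A => -I • (2 : ℝ)⁻¹ • (A - star A) := by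
      funext A; exact imaginaryPart_apply_coe A
    rw [this]
    fun_prop

lemma opIm_I_smul (A : L →L[ℂ] L) : opIm (I • A) = opRe A := by
  exact congrArg Subtype.val (imaginaryPart_I_smul A)

lemma opRe_smul (c : ℝ) (A : L →L[ℂ] L) : opRe (c • A) = c • opRe A := by
  simp [opRe]

end Operators

end KramersKronig

theorem theorem3 {L : Type*} [NormedAddCommGroup L] [InnerProductSpace ℂ L] [CompleteSpace L]
    (K : ℝ → (L →L[ℂ] L))
    (hcausal : KramersKronig.IsCausal K)
    (hint : Integrable K volume)
    (hhardy : KramersKronig.MemHardy 1 (KramersKronig.laplace K)) :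
    ∃ Kb : ℝ → (L →L[ℂ] L),
      (∀ᵐ ω : ℝ, KramersKronig.HasBoundaryValue (KramersKronig.laplace K) ω (Kb ω)) ∧
      (∀ᵐ ω : ℝ, ∃ v : L →L[ℂ] L,
        KramersKronig.HasPrincipalValue (fun s => KramersKronig.opIm (Kb s)) ω v ∧
        KramersKronig.opRe (Kb ω) = (1 / Real.pi) • v) ∧
      (∀ᵐ ω : ℝ, ∀ ξ η : L, ∃ v : ℝ,
        KramersKronig.HasPrincipalValue (fun s => (inner ℂ ξ (Kb s η)).im) ω v ∧
        (inner ℂ ξ (Kb ω η)).re = (1 / Real.pi) * v) := by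
  have hpv := KramersKronig.hasPrincipalValue_laplace hint hhardy
  refine ⟨fun ω => KramersKronig.laplace K ω,
    Eventually.of_forall (KramersKronig.hasBoundaryValue_laplace hint),
    Eventually.of_forall fun ω => ⟨_, (hpv ω).map KramersKronig.opImCLM, ?_⟩,
    Eventually.of_forall fun ω ξ η =>
      ⟨_, (hpv ω).map (KramersKronig.imMatrixElementCLM ξ η), ?_⟩⟩
  · change _ = (1 / Real.pi) • KramersKronig.opIm _
    rw [KramersKronig.opIm_I_smul, KramersKronig.opRe_smul, smul_smul,
      one_div_mul_cancel Real.pi_ne_zero, one_smul]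
  · rw [KramersKronig.imMatrixElementCLM_I_smul]
    field_simp
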